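/- A $k$-cycle system of order $v$ is a collection of $k$-cycles whose edge sets partition the edge set of the complete graph $K_v$. A $k$-cycle system of order $v\equiv 1\pmod{2k}$ is called almost resolvable, and is denoted by $k$-ARCS$(v)$, if its set of cycles can be partitioned into $(v-1)/2$ almost parallel classes, each consisting of $(v-1)/k$ pairwise vertex-disjoint $k$-cycles, and one half-parallel class, consisting of $(v-1)/(2k)$ pairwise vertex-disjoint $k$-cycles. For every $k\ge 18$ with $k\equiv 2\pmod 4$, there exists a $k$-ARCS$(2k+1)$. -/

import Mathlib

/-- A `k`-cycle of the complete graph on `V`: a subgraph isomorphic to the cycle `C_k`, `k ≥ 3`. -/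
def IsKCycle {V : Type*} (k : ℕ) (C : (⊤ : SimpleGraph V).Subgraph) : Prop :=
  3 ≤ k ∧ Nonempty (SimpleGraph.cycleGraph k ≃g C.coe)

/-- A `k`-cycle system on the vertex set `V`: a collection of `k`-cycles whose edge sets
partition the edge set of the complete graph on `V`. -/
def IsCycleSystem {V : Type*} (k : ℕ) (S : Set (⊤ : SimpleGraph V).Subgraph) : Prop :=
  (∀ C ∈ S, IsKCycle k C) ∧
    ∀ e ∈ (⊤ : SimpleGraph V).edgeSet, ∃! C : (⊤ : SimpleGraph V).Subgraph, C ∈ S ∧ e ∈ C.edgeSet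

/-- A collection of exactly `m` pairwise vertex-disjoint subgraphs. -/
def IsDisjointFamily {V : Type*} (m : ℕ) (P : Set (⊤ : SimpleGraph V).Subgraph) : Prop :=
  P.encard = m ∧ P.PairwiseDisjoint SimpleGraph.Subgraph.verts

/-- An almost resolvable `k`-cycle system on a vertex set `V` of order `v ≡ 1 (mod 2k)`:
a `k`-cycle system whose set of cycles is partitioned into `(v - 1) / 2` almost parallel classes
`P i`, each consisting of `(v - 1) / k` vertex-disjoint `k`-cycles, and one half-parallel class
`H`, consisting of `(v - 1) / (2k)` vertex-disjoint `k`-cycles. -/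
def IsAlmostResolvableCycleSystem {V : Type*} [Fintype V] (k : ℕ)
    (S : Set (⊤ : SimpleGraph V).Subgraph) : Prop :=
  Fintype.card V ≡ 1 [MOD 2 * k] ∧
  IsCycleSystem k S ∧
  ∃ (P : Fin ((Fintype.card V - 1) / 2) → Set (⊤ : SimpleGraph V).Subgraph)
    (H : Set (⊤ : SimpleGraph V).Subgraph),
    (∀ i, IsDisjointFamily ((Fintype.card V - 1) / k) (P i)) ∧
    IsDisjointFamily ((Fintype.card V - 1) / (2 * k)) H ∧
    (∀ i j, i ≠ j → Disjoint (P i) (P j)) ∧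
    (∀ i, Disjoint (P i) H) ∧
    (⋃ i, P i) ∪ H = S

/-- There exists a `k`-ARCS`(v)`: an almost resolvable `k`-cycle system on some `v`-element
vertex set. -/
def ExistsARCS (k v : ℕ) : Prop :=
  ∃ (V : Type) (_ : Fintype V), Fintype.card V = v ∧
    ∃ S : Set (⊤ : SimpleGraph V).Subgraph, IsAlmostResolvableCycleSystem k S

/-!
Write `k = 2m` with `m = 2t + 1`. The complete graph on `2k + 1 = 4m + 1` vertices is built on four
copies of `ZMod m` and a point at infinity, so that `ZMod m` acts by translation with one fixed
point. Two *base classes*, each consisting of two disjoint `k`-cycles which miss a single vertex,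
have `2m = k` translates; these are the almost parallel classes. The half-parallel class is one
`k`-cycle which is itself invariant under translation and uses two differences between the copies
`0` and `1` (`halfClass`). By counting edges, the result is a cycle system as soon as every edge is
covered (`existsARCS_of_cover`), and for this it suffices that every difference within or between
the copies, as well as every copy's edge to infinity, occurs in a base cycle
(`existsARCS_of_differences`).

The base cycles are made of zigzags `p, q, p + 1, q - 1, …`, whose consecutive differences run
through an interval. In the first base class, `cycleA` combines a zigzag within copy `0`, one
within copy `1`, and one between the two, while `cycleB` does the same for the copies `2` and `3`.
In the second base class, `cycleC` joins copy `0` to the copies `2` and `3`, and `cycleD` joins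
copy `1` to them. The zigzags leave a bounded number of differences uncovered. These are supplied by
the edges joining consecutive zigzags, and by exchanging one vertex within each class: `cycleA`
visits a point of copy `3`, `cycleB` a point of copy `1`, and `cycleD` a point of copy `0`. The
middle of a zigzag inside a single copy depends on the parity of `t`; this is compensated by
reflecting the copies `2` and `3` in the first base class when `t` is even (`reflectIfEven`).
-/

/-! ### Cycle systems from families of cyclic sequences -/

section Sequences

variable {V : Type*} {k : ℕ}

/-- The cycle of the complete graph which visits the values of `c` in cyclic order. -/
def cycleOfEmbedding (c : Fin k ↪ V) : (⊤ : SimpleGraph V).Subgraph :=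
  SimpleGraph.Copy.toSubgraph (A := SimpleGraph.cycleGraph k)
    ⟨⟨c, fun h => by simpa using h.ne⟩, c.injective⟩

theorem isKCycle_cycleOfEmbedding (hk : 3 ≤ k) (c : Fin k ↪ V) :
    IsKCycle k (cycleOfEmbedding c) :=
  ⟨hk, ⟨SimpleGraph.Copy.isoToSubgraph _⟩⟩

theorem verts_cycleOfEmbedding (c : Fin k ↪ V) : (cycleOfEmbedding c).verts = Set.range c := by
  simp [cycleOfEmbedding, SimpleGraph.Copy.toSubgraph]

theorem mem_edgeSet_cycleOfEmbedding [NeZero k] (hk : 3 ≤ k) (c : Fin k ↪ V) (e : Sym2 V) :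
    e ∈ (cycleOfEmbedding c).edgeSet ↔ ∃ n : Fin k, e = s(c n, c (n + 1)) := by
  obtain ⟨j, rfl⟩ : ∃ j, k = j + 2 := ⟨k - 2, by omega⟩
  induction e using Sym2.ind with
  | _ u v =>
    simp only [SimpleGraph.Subgraph.mem_edgeSet, cycleOfEmbedding, SimpleGraph.Copy.toSubgraph,
      SimpleGraph.Subgraph.map_adj, Relation.Map, SimpleGraph.Subgraph.top_adj,
      SimpleGraph.cycleGraph_adj]
    constructor
    · rintro ⟨a, b, h | h, rfl, rfl⟩
      · exact ⟨b, by rw [← h, add_sub_cancel]; exact Sym2.eq_swap⟩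
      · exact ⟨a, by rw [← h, add_sub_cancel]; rfl⟩
    · rintro ⟨n, hn⟩
      rcases Sym2.eq_iff.1 hn with ⟨rfl, rfl⟩ | ⟨rfl, rfl⟩
      · exact ⟨n, n + 1, Or.inr (by simp), rfl, rfl⟩
      · exact ⟨n + 1, n, Or.inl (by simp), rfl, rfl⟩

variable [Fintype V] {J : Type*} [Fintype J] [NeZero k]

/-- If the number of edges is right, then sequences covering all edges cover each edge once. -/
theorem edge_injective_of_cover (hk : 3 ≤ k) (c : J → Fin k ↪ V)
    (hcard : Fintype.card J * k = (Fintype.card V).choose 2)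
    (hcover : ∀ u v : V, u ≠ v → ∃ j n, s(u, v) = s(c j n, c j (n + 1))) :
    Function.Injective fun x : J × Fin k => s(c x.1 x.2, c x.1 (x.2 + 1)) := by
  classical
  have hne : ∀ n : Fin k, n ≠ n + 1 := by
    intro n h
    have h1 : (1 : Fin k) = 0 := by simpa using h.symm
    obtain ⟨j, rfl⟩ : ∃ j, k = j + 2 := ⟨k - 2, by omega⟩
    exact one_ne_zero h1
  let φ : J × Fin k → {e : Sym2 V // ¬ e.IsDiag} := fun x =>
    ⟨s(c x.1 x.2, c x.1 (x.2 + 1)), by simpa using hne x.2⟩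
  have hφ : Function.Surjective φ := by
    rintro ⟨e, he⟩
    induction e using Sym2.ind with
    | _ u v =>
      obtain ⟨j, n, h⟩ := hcover u v (by simpa using he)
      exact ⟨(j, n), Subtype.ext h.symm⟩
  have hb : Function.Bijective φ := by
    refine (Fintype.bijective_iff_surjective_and_card φ).2 ⟨hφ, ?_⟩
    rw [Sym2.card_subtype_not_diag, Fintype.card_prod, Fintype.card_fin, hcard]
  intro x y hxy
  exact hb.1 (Subtype.ext hxy)

theorem cycleOfEmbedding_injective_of_cover (hk : 3 ≤ k) (c : J → Fin k ↪ V)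
    (hcard : Fintype.card J * k = (Fintype.card V).choose 2)
    (hcover : ∀ u v : V, u ≠ v → ∃ j n, s(u, v) = s(c j n, c j (n + 1))) :
    Function.Injective fun j => cycleOfEmbedding (c j) := by
  intro i j hij
  have h : s(c i 0, c i (0 + 1)) ∈ (cycleOfEmbedding (c j)).edgeSet := by
    rw [← show cycleOfEmbedding (c i) = cycleOfEmbedding (c j) from hij]
    exact (mem_edgeSet_cycleOfEmbedding hk _ _).2 ⟨0, rfl⟩
  obtain ⟨n, hn⟩ := (mem_edgeSet_cycleOfEmbedding hk _ _).1 h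
  exact congrArg Prod.fst
    (edge_injective_of_cover hk c hcard hcover (a₁ := (i, 0)) (a₂ := (j, n)) hn)

theorem isCycleSystem_of_cover (hk : 3 ≤ k) (c : J → Fin k ↪ V)
    (hcard : Fintype.card J * k = (Fintype.card V).choose 2)
    (hcover : ∀ u v : V, u ≠ v → ∃ j n, s(u, v) = s(c j n, c j (n + 1))) :
    IsCycleSystem k (Set.range fun j => cycleOfEmbedding (c j)) := by
  refine ⟨?_, ?_⟩
  · rintro _ ⟨j, rfl⟩
    exact isKCycle_cycleOfEmbedding hk _
  · intro e he
    induction e using Sym2.ind with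
    | _ u v =>
      obtain ⟨j, n, h⟩ := hcover u v (by simpa using he)
      refine ⟨cycleOfEmbedding (c j), ⟨⟨j, rfl⟩, (mem_edgeSet_cycleOfEmbedding hk _ _).2 ⟨n, h⟩⟩, ?_⟩
      rintro _ ⟨⟨i, rfl⟩, hi⟩
      obtain ⟨n', h'⟩ := (mem_edgeSet_cycleOfEmbedding hk _ _).1 hi
      have := edge_injective_of_cover hk c hcard hcover (a₁ := (i, n')) (a₂ := (j, n))
        (h'.symm.trans h)
      obtain ⟨rfl, -⟩ := Prod.ext_iff.1 this
      rfl

end Sequences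

/-- A family of `k` pairs of disjoint cyclic sequences, together with one further sequence, which
covers all edges of the complete graph on `2k + 1` vertices is a `k`-ARCS`(2k + 1)`. -/
theorem existsARCS_of_cover {V ι : Type} [Fintype V] [Fintype ι] {k : ℕ} [NeZero k] (hk : 3 ≤ k)
    (hV : Fintype.card V = 2 * k + 1) (hι : Fintype.card ι = k)
    (c : ι → Bool → Fin k → V) (h : Fin k → V)
    (hc : ∀ i, Function.Injective fun x : Bool × Fin k => c i x.1 x.2)
    (hh : Function.Injective h)
    (hcover : ∀ u v : V, u ≠ v → (∃ i b n, s(u, v) = s(c i b n, c i b (n + 1))) ∨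
      ∃ n, s(u, v) = s(h n, h (n + 1))) :
    ExistsARCS k (2 * k + 1) := by
  classical
  have hcb : ∀ i b, Function.Injective (c i b) := fun i b x y hxy =>
    congrArg Prod.snd (hc i (a₁ := (b, x)) (a₂ := (b, y)) hxy)
  let d : (ι × Bool) ⊕ Unit → Fin k ↪ V :=
    Sum.elim (fun x => ⟨c x.1 x.2, hcb x.1 x.2⟩) fun _ => ⟨h, hh⟩
  have hcard : Fintype.card ((ι × Bool) ⊕ Unit) * k = (Fintype.card V).choose 2 := by
    rw [Fintype.card_sum, Fintype.card_prod, hι, hV, Nat.choose_two_right, Fintype.card_bool,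
      Fintype.card_unit]
    refine (Nat.div_eq_of_eq_mul_right two_pos ?_).symm
    rw [Nat.add_sub_cancel]
    ring
  have hcover' : ∀ u v : V, u ≠ v → ∃ j n, s(u, v) = s(d j n, d j (n + 1)) := by
    intro u v huv
    rcases hcover u v huv with ⟨i, b, n, hn⟩ | ⟨n, hn⟩
    · exact ⟨Sum.inl (i, b), n, hn⟩
    · exact ⟨Sum.inr (), n, hn⟩
  have hinj := cycleOfEmbedding_injective_of_cover hk d hcard hcover'
  let C : (ι × Bool) ⊕ Unit → (⊤ : SimpleGraph V).Subgraph := fun j => cycleOfEmbedding (d j)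
  have hC : Function.Injective C := hinj
  have hclasses : Fintype.card (Fin ((Fintype.card V - 1) / 2)) = Fintype.card ι := by
    rw [Fintype.card_fin, hV, hι]; omega
  let e := Fintype.equivOfCardEq hclasses
  refine ⟨V, inferInstance, hV, Set.range C, ?_, isCycleSystem_of_cover hk d hcard hcover',
    fun i => {C (Sum.inl (e i, false)), C (Sum.inl (e i, true))}, {C (Sum.inr ())}, ?_, ?_, ?_, ?_,
    ?_⟩
  · rw [hV]
    simp [Nat.ModEq]
  · intro i
    have hdisj : Disjoint (C (Sum.inl (e i, false))).verts (C (Sum.inl (e i, true))).verts := by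
      simp only [C, verts_cycleOfEmbedding]
      rw [Set.disjoint_left]
      rintro _ ⟨x, rfl⟩ ⟨y, hxy⟩
      have := hc (e i) (a₁ := (true, y)) (a₂ := (false, x)) hxy
      simp at this
    refine ⟨?_, ?_⟩
    · rw [Set.encard_pair (hC.ne (by simp)), hV, Nat.add_sub_cancel,
        Nat.mul_div_cancel _ (by omega)]
      rfl
    · rw [Set.pairwiseDisjoint_insert]
      refine ⟨Set.pairwiseDisjoint_singleton _ _, ?_⟩
      rintro _ rfl -
      exact hdisj
  · refine ⟨?_, Set.pairwiseDisjoint_singleton _ _⟩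
    rw [Set.encard_singleton, hV, Nat.add_sub_cancel, Nat.div_self (by omega)]
    rfl
  · intro i j hij
    simp [hC.eq_iff, hij.symm]
  · intro i
    simp [hC.eq_iff]
  · ext x
    simp only [Set.mem_union, Set.mem_iUnion, Set.mem_insert_iff, Set.mem_singleton_iff,
      Set.mem_range]
    constructor
    · rintro (⟨i, rfl | rfl⟩ | rfl) <;> exact ⟨_, rfl⟩
    · rintro ⟨⟨i, b⟩ | _, rfl⟩
      · obtain ⟨j, rfl⟩ := e.surjective i
        cases b
        · exact Or.inl ⟨j, Or.inl rfl⟩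
        · exact Or.inl ⟨j, Or.inr rfl⟩
      · exact Or.inr rfl

/-! ### The method of differences -/

/-- An integral representative of a vertex: `some (i, p)` is the point `p` of the `i`-th of four
copies of `ZMod m`, and `none` is the point at infinity. -/
abbrev Point : Type := Option (Fin 4 × ℤ)

/-- Reduction of the positions modulo `m`. -/
def Point.toVertex (m : ℕ) : Point → Option (Fin 4 × ZMod m) :=
  Option.map fun x => (x.1, (x.2 : ZMod m))

/-- Translation by `s` on all four copies of `ZMod m`, fixing the point at infinity. -/
def shiftVertex {m : ℕ} (s : ZMod m) : Option (Fin 4 × ZMod m) → Option (Fin 4 × ZMod m) :=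
  Option.map fun x => (x.1, x.2 + s)

theorem shiftVertex_injective {m : ℕ} (s : ZMod m) : Function.Injective (shiftVertex s) := by
  refine Option.map_injective fun x y h => ?_
  simpa [Prod.ext_iff] using h

/-- `x` and `y` follow each other, in either order, in the cyclic sequence `f 0, …, f (k - 1)`. -/
def Consecutive {X : Type*} (k : ℕ) (f : ℕ → X) (x y : X) : Prop :=
  ∃ n < k, s(x, y) = s(f n, f ((n + 1) % k))

section Consecutive

variable {X : Type*} {k : ℕ} {f : ℕ → X} {x y : X}

theorem Consecutive.symm (h : Consecutive k f x y) : Consecutive k f y x := by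
  obtain ⟨n, hn, h⟩ := h
  exact ⟨n, hn, Sym2.eq_swap.trans h⟩

theorem Consecutive.map {Y : Type*} (g : X → Y) (h : Consecutive k f x y) :
    Consecutive k (fun n => g (f n)) (g x) (g y) := by
  obtain ⟨n, hn, h⟩ := h
  exact ⟨n, hn, by simpa using congrArg (Sym2.map g) h⟩

theorem consecutive_of_lt (n : ℕ) (hn : n + 1 < k) (hx : f n = x) (hy : f (n + 1) = y) :
    Consecutive k f x y :=
  ⟨n, by omega, by rw [Nat.mod_eq_of_lt hn, hx, hy]⟩

theorem consecutive_last (hk : 0 < k) (hx : f (k - 1) = x) (hy : f 0 = y) :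
    Consecutive k f x y :=
  ⟨k - 1, by omega, by rw [Nat.sub_add_cancel hk, Nat.mod_self, hx, hy]⟩

end Consecutive

theorem exists_intCast_eq {m : ℕ} [NeZero m] (lo : ℤ) (d : ZMod m) :
    ∃ p : ℤ, lo ≤ p ∧ p < lo + m ∧ (p : ZMod m) = d := by
  have hm : (0 : ℤ) < m := by exact_mod_cast Nat.pos_of_ne_zero (NeZero.ne m)
  refine ⟨lo + ((d - lo : ZMod m).val : ℤ), by omega, ?_, ?_⟩
  · have := ZMod.val_lt (d - lo : ZMod m)
    omega
  · push_cast
    rw [ZMod.natCast_zmod_val]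
    ring

theorem intCast_inj_of_window {m : ℕ} {lo p q : ℤ} (hp : lo ≤ p ∧ p < lo + m)
    (hq : lo ≤ q ∧ q < lo + m) (h : (p : ZMod m) = q) : p = q := by
  rw [ZMod.intCast_eq_intCast_iff_dvd_sub] at h
  have := Int.eq_zero_of_abs_lt_dvd h (by rw [abs_lt]; omega)
  omega

/-- Reduction modulo `m` is injective on points whose positions lie in windows of length `m`. -/
theorem toVertex_inj_of_window {m : ℕ} {lo : Fin 4 → ℤ} {x y : Point}
    (hx : ∀ z ∈ x, lo z.1 ≤ z.2 ∧ z.2 < lo z.1 + m)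
    (hy : ∀ z ∈ y, lo z.1 ≤ z.2 ∧ z.2 < lo z.1 + m)
    (h : x.toVertex m = y.toVertex m) : x = y := by
  rcases x with _ | ⟨i, p⟩ <;> rcases y with _ | ⟨j, q⟩ <;>
    simp only [Point.toVertex, Option.map_none, Option.map_some, reduceCtorEq, Option.some.injEq,
      Prod.mk.injEq] at h
  · rfl
  · obtain ⟨rfl, h⟩ := h
    obtain rfl : p = q := intCast_inj_of_window (hx (i, p) rfl) (hy (i, q) rfl) h
    rfl

/-- The half-parallel class: the cycle through the edges of differences `1` and `2` between the
copies `0` and `1` of `ZMod m`. -/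
def halfClass (n : ℕ) : Point :=
  if n % 2 = 0 then some (0, n / 2) else some (1, n / 2 + 2)

theorem halfClass_injOn {m n n' : ℕ} (hn : n < 2 * m) (hn' : n' < 2 * m)
    (h : (halfClass n).toVertex m = (halfClass n').toVertex m) : n = n' := by
  have hw : ∀ n < 2 * m, ∀ z ∈ halfClass n, (![0, 2, 0, 0] : Fin 4 → ℤ) z.1 ≤ z.2 ∧
      z.2 < (![0, 2, 0, 0] : Fin 4 → ℤ) z.1 + m := by
    intro n hn z hz
    unfold halfClass at hz
    split_ifs at hz <;> obtain rfl : _ = z := Option.some.inj hz <;> simp <;> omega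
  have := toVertex_inj_of_window (hw n hn) (hw n' hn') h
  unfold halfClass at this
  split_ifs at this <;> simp at this <;> omega

theorem consecutive_halfClass {m : ℕ} [NeZero m] (x y : ZMod m) (h : y - x = 1 ∨ y - x = 2) :
    Consecutive (2 * m) (fun n => (halfClass n).toVertex m) (some (0, x)) (some (1, y)) := by
  have hm : 0 < m := Nat.pos_of_ne_zero (NeZero.ne m)
  have hev : ∀ s : ℕ, (halfClass (2 * s)).toVertex m = some (0, (s : ZMod m)) := by
    intro s
    simp [halfClass, Point.toVertex]
  have hodd : ∀ s : ℕ, (halfClass (2 * s + 1)).toVertex m = some (1, (s : ZMod m) + 2) := by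
    intro s
    have h1 : (2 * s + 1) % 2 ≠ 0 := by omega
    have h2 : (((2 * s + 1 : ℕ) : ℤ) / 2) = s := by omega
    simp only [halfClass, h1, if_false, h2, Point.toVertex, Option.map_some]
    push_cast
    rfl
  rcases h with h | h
  · refine Consecutive.symm ?_
    have hlt := ZMod.val_lt (y - 2)
    have hs : (((y - 2).val : ℕ) : ZMod m) = y - 2 := ZMod.natCast_zmod_val _
    have hx : x = y - 2 + 1 := by linear_combination -h
    have h1 : (halfClass (2 * (y - 2).val + 1)).toVertex m = some (1, y) := by
      rw [hodd, hs, sub_add_cancel]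
    rcases Nat.lt_or_ge ((y - 2).val + 1) m with hl | hl
    · refine consecutive_of_lt (2 * (y - 2).val + 1) (by omega) h1 ?_
      rw [show 2 * (y - 2).val + 1 + 1 = 2 * ((y - 2).val + 1) by ring, hev, Nat.cast_add, hs, hx,
        Nat.cast_one]
    · have hval : (y - 2).val = m - 1 := by omega
      refine consecutive_last (by omega) ?_ ?_
      · rw [← h1, show 2 * (y - 2).val + 1 = 2 * m - 1 by omega]
      · rw [show 0 = 2 * 0 by rfl, hev, hx, ← hs, hval, Nat.cast_sub (by omega)]
        simp
  · have hlt := ZMod.val_lt x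
    refine consecutive_of_lt (2 * x.val) (by omega) ?_ ?_
    · rw [hev, ZMod.natCast_zmod_val]
    · rw [hodd, ZMod.natCast_zmod_val, ← h, add_sub_cancel]

/-- The difference `d` from copy `i` to copy `j` of `ZMod m` occurs in the cyclic sequence `f`. -/
def HasDifference (m : ℕ) (f : ℕ → Point) (i j : Fin 4) (d : ZMod m) : Prop :=
  ∃ p q : ℤ, Consecutive (2 * m) f (some (i, p)) (some (j, q)) ∧ ((q - p : ℤ) : ZMod m) = d

section HasDifference

variable {m : ℕ} {f : ℕ → Point} {i j : Fin 4}

theorem HasDifference.symm {d : ZMod m} (h : HasDifference m f i j d) :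
    HasDifference m f j i (-d) := by
  obtain ⟨p, q, h, rfl⟩ := h
  exact ⟨q, p, h.symm, by push_cast; ring⟩

theorem HasDifference.exists_shiftVertex {x y : ZMod m} (h : HasDifference m f i j (y - x)) :
    ∃ s, Consecutive (2 * m) (fun n => shiftVertex s ((f n).toVertex m))
      (some (i, x)) (some (j, y)) := by
  obtain ⟨p, q, h, hd⟩ := h
  have hq : (q : ZMod m) + (x - p) = y := by
    push_cast at hd
    linear_combination hd
  refine ⟨x - (p : ZMod m), ?_⟩
  simpa [shiftVertex, Point.toVertex, hq] using
    h.map fun z => shiftVertex (x - (p : ZMod m)) (z.toVertex m)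

end HasDifference

/-- The method of differences: two classes, each of two base cycles of length `2m`, are developed
by the `m` translations. If the base cycles in each class are vertex-disjoint, and together they
contain an edge from infinity to each copy, every non-zero pure difference and every mixed
difference except `1` and `2` between the copies `0` and `1`, which belong to the half-parallel
class, then the outcome is almost resolvable. -/
theorem existsARCS_of_differences {m : ℕ} [NeZero m] (hm : 2 ≤ m)
    (a : Fin 2 → Bool → ℕ → Point)
    (hinj : ∀ c b b' n n', n < 2 * m → n' < 2 * m →
      (a c b n).toVertex m = (a c b' n').toVertex m → b = b' ∧ n = n')
    (hinfty : ∀ i, ∃ c b p, Consecutive (2 * m) (a c b) none (some (i, p)))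
    (hpure : ∀ i d, d ≠ 0 → ∃ c b, HasDifference m (a c b) i i d)
    (hmixed : ∀ i j d, i < j →
      (∃ c b, HasDifference m (a c b) i j d) ∨ i = 0 ∧ j = 1 ∧ (d = 1 ∨ d = 2)) :
    ExistsARCS (2 * m) (2 * (2 * m) + 1) := by
  have : NeZero (2 * m) := ⟨by omega⟩
  have hfin : ∀ {f : ℕ → Option (Fin 4 × ZMod m)} {x y}, Consecutive (2 * m) f x y →
      ∃ n : Fin (2 * m), s(x, y) = s(f n, f ((n + 1 : Fin (2 * m)) : ℕ)) := by
    rintro f x y ⟨n, hn, h⟩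
    refine ⟨⟨n, hn⟩, ?_⟩
    rw [h, Fin.val_add, Fin.val_one', Nat.add_mod_mod]
  refine existsARCS_of_cover (V := Option (Fin 4 × ZMod m)) (ι := Fin 2 × ZMod m) (by omega)
    ?_ ?_ (fun i b n => shiftVertex i.2 ((a i.1 b n).toVertex m))
    (fun n => (halfClass n).toVertex m) ?_ ?_ ?_
  · rw [Fintype.card_option, Fintype.card_prod, ZMod.card, Fintype.card_fin]
    ring
  · rw [Fintype.card_prod, ZMod.card, Fintype.card_fin]
  · rintro i ⟨b, n⟩ ⟨b', n'⟩ h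
    obtain ⟨rfl, hn⟩ := hinj _ _ _ _ _ n.2 n'.2 (shiftVertex_injective _ h)
    rw [Fin.ext hn]
  · intro n n' h
    exact Fin.ext (halfClass_injOn n.2 n'.2 h)
  · suffices H : ∀ u v : Option (Fin 4 × ZMod m), u ≠ v →
        (∃ c s b, Consecutive (2 * m) (fun n => shiftVertex s ((a c b n).toVertex m)) u v) ∨
          Consecutive (2 * m) (fun n => (halfClass n).toVertex m) u v by
      intro u v huv
      rcases H u v huv with ⟨c, s, b, h⟩ | h
      · obtain ⟨n, hn⟩ := hfin h
        exact Or.inl ⟨(c, s), b, n, hn⟩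
      · exact Or.inr (hfin h)
    have hinf : ∀ z : Fin 4 × ZMod m,
        ∃ c s b, Consecutive (2 * m) (fun n => shiftVertex s ((a c b n).toVertex m))
          none (some z) := by
      rintro ⟨i, x⟩
      obtain ⟨c, b, p, h⟩ := hinfty i
      refine ⟨c, x - (p : ZMod m), b, ?_⟩
      simpa [shiftVertex, Point.toVertex] using
        h.map fun z => shiftVertex (x - (p : ZMod m)) (z.toVertex m)
    have hlt : ∀ (i j : Fin 4) (x y : ZMod m), i < j →
        (∃ c s b, Consecutive (2 * m) (fun n => shiftVertex s ((a c b n).toVertex m))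
          (some (i, x)) (some (j, y))) ∨
        Consecutive (2 * m) (fun n => (halfClass n).toVertex m) (some (i, x)) (some (j, y)) := by
      intro i j x y hij
      rcases hmixed i j (y - x) hij with ⟨c, b, h⟩ | ⟨rfl, rfl, h⟩
      · obtain ⟨s, h⟩ := h.exists_shiftVertex
        exact Or.inl ⟨c, s, b, h⟩
      · exact Or.inr (consecutive_halfClass x y h)
    rintro (_ | ⟨i, x⟩) (_ | ⟨j, y⟩) huv
    · exact absurd rfl huv
    · exact Or.inl (hinf _)
    · obtain ⟨c, s, b, h⟩ := hinf (i, x)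
      exact Or.inl ⟨c, s, b, h.symm⟩
    · rcases lt_trichotomy i j with hij | rfl | hij
      · exact hlt i j x y hij
      · obtain ⟨c, b, h⟩ := hpure i (y - x) fun h => huv (by rw [sub_eq_zero.1 h])
        obtain ⟨s, h⟩ := h.exists_shiftVertex
        exact Or.inl ⟨c, s, b, h⟩
      · rcases hlt j i y x hij with ⟨c, s, b, h⟩ | h
        · exact Or.inl ⟨c, s, b, h.symm⟩
        · exact Or.inr h.symm

/-! ### Zigzag paths and the base cycles -/

/-- The zigzag `(i, p), (j, q), (i, p + 1), (j, q - 1), …`, whose successive differences from `i`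
to `j` are `q - p`, `q - p - 1`, …. -/
def zigzag (i j : Fin 4) (p q : ℤ) (n : ℕ) : Point :=
  if n % 2 = 0 then some (i, p + (n / 2 : ℕ)) else some (j, q - (n / 2 : ℕ))

theorem exists_zigzag_edge (i j : Fin 4) (p q : ℤ) (n : ℕ) :
    ∃ x y : ℤ, y - x = q - p - n ∧
      s(some (i, x), some (j, y)) = s(zigzag i j p q n, zigzag i j p q (n + 1)) := by
  obtain ⟨s, rfl | rfl⟩ := n.even_or_odd'
  · refine ⟨p + s, q - s, by push_cast; ring, ?_⟩
    rw [zigzag, if_pos (by omega), zigzag, if_neg (by omega), show 2 * s / 2 = s by omega,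
      show (2 * s + 1) / 2 = s by omega]
  · refine ⟨p + (s + 1), q - s, by push_cast; ring, ?_⟩
    rw [zigzag, if_neg (by omega), zigzag, if_pos (by omega), show (2 * s + 1) / 2 = s by omega,
      show (2 * s + 1 + 1) / 2 = s + 1 by omega, Sym2.eq_swap]
    push_cast
    rfl

theorem exists_zigzag_self (i : Fin 4) (p q : ℤ) (n : ℕ) :
    ∃ x, zigzag i i p q n = some (i, x) := by
  unfold zigzag
  split_ifs <;> exact ⟨_, rfl⟩

section

variable {m : ℕ} {f : ℕ → Point} {i j : Fin 4}

/-- A difference `q - p` equals `d` modulo `m` as soon as `q - p = d + c * m` for some `c`. -/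
theorem HasDifference.of_consecutive {p q d : ℤ} (c : ℤ)
    (h : Consecutive (2 * m) f (some (i, p)) (some (j, q))) (hd : q - p = d + c * m) :
    HasDifference m f i j d :=
  ⟨p, q, h, by rw [hd]; simp⟩

/-- A stretch of `f` along a zigzag contributes the differences of the zigzag. -/
theorem HasDifference.of_zigzag {p q d : ℤ} (N n : ℕ) (c : ℤ) (hN : N + 1 < 2 * m)
    (h₁ : f N = zigzag i j p q n) (h₂ : f (N + 1) = zigzag i j p q (n + 1))
    (hd : q - p - n = d + c * m) : HasDifference m f i j d := by
  obtain ⟨x, y, hxy, h⟩ := exists_zigzag_edge i j p q n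
  exact .of_consecutive c ⟨N, by omega, by rw [h, Nat.mod_eq_of_lt hN, h₁, h₂]⟩ (hxy.trans hd)

/-- A stretch of `f` along a reversed zigzag contributes the differences of the zigzag. -/
theorem HasDifference.of_zigzag_reverse {p q d : ℤ} (N n : ℕ) (c : ℤ) (hN : N + 1 < 2 * m)
    (h₁ : f N = zigzag i j p q (n + 1)) (h₂ : f (N + 1) = zigzag i j p q n)
    (hd : q - p - n = d + c * m) : HasDifference m f i j d := by
  obtain ⟨x, y, hxy, h⟩ := exists_zigzag_edge i j p q n
  exact .of_consecutive c
    ⟨N, by omega, by rw [h, Nat.mod_eq_of_lt hN, h₁, h₂, Sym2.eq_swap]⟩ (hxy.trans hd)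

end

/-- The first cycle of the first base class. It starts at the point `1` of copy `3`, follows zigzags
between the copies `1` and `0` and then within copy `1`, passes through infinity, and returns along
the reversed zigzag within copy `0`. It misses the points `2t` of copy `0` and `0` of copy `1`. -/
def cycleA (t n : ℕ) : Point :=
  if n = 0 then some (3, 1)
  else if n ≤ 2 * t - 1 then zigzag 1 0 1 (2 * t - 1) (n - 1)
  else if n ≤ 3 * t - 1 then zigzag 1 1 t (2 * t) (n - (2 * t - 1))
  else if n = 3 * t then none
  else zigzag 0 0 0 t (4 * t + 1 - n)

/-- The second cycle of the first base class, up to the reflection for even `t`: a reversed zigzag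
within copy `2`, one between the copies `3` and `2`, and one within copy `3`. The zigzag in the
middle would pass through the point `1` of copy `3`, which belongs to `cycleA`; the detour through
the point `0` of copy `1` replaces it. -/
def cycleB (t n : ℕ) : Point :=
  if n ≤ t then zigzag 2 2 (t / 2 : ℕ) ((t / 2 : ℕ) + t) (t - n)
  else if n = t + 1 + 2 * (t / 2) then some (1, 0)
  else if n ≤ 3 * t + 1 then zigzag 3 2 (1 - (t / 2 : ℕ)) ((t / 2 : ℕ) - 1) (n - (t + 1))
  else zigzag 3 3 (t - (t / 2 : ℕ) + 1) (2 * t - (t / 2 : ℕ) + 1) (n - (3 * t + 1))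

/-- The first cycle of the second base class: from infinity along a zigzag between the copies `0` and
`2`, continued by one between the copies `0` and `3`. It misses the point `2t` of copy `0`. -/
def cycleC (t n : ℕ) : Point :=
  if n = 0 then none
  else if n ≤ 2 * t + 2 then zigzag 0 2 (-1) (2 * t) n
  else zigzag 0 3 t (t - 1) (n - (2 * t + 2))

/-- The second cycle of the second base class: from the point `2t` of copy `0` along a zigzag between
the copies `2` and `1`, continued by one between the copies `3` and `1`. It misses the point `t` of
copy `1`. -/
def cycleD (t n : ℕ) : Point :=
  if n = 0 then some (0, 2 * t)
  else if n ≤ 2 * t then zigzag 2 1 (-1) (2 * t) n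
  else zigzag 3 1 t (t - 1) (n - (2 * t + 1))

/-- The reflections `p ↦ -1 - p` of copy `2` and `p ↦ 2 - p` of copy `3`, and the identity elsewhere.
They exchange the neighbours `0` and `-1`, in copy `2`, of the point of copy `1` on `cycleB`, and they
fix the point of copy `3` on `cycleA`; a difference `d` from copy `2` to copy `3` becomes `3 - d`. -/
def reflect : Point → Point :=
  Option.map fun x => (x.1, (![x.2, x.2, -1 - x.2, 2 - x.2] : Fin 4 → ℤ) x.1)

/-- The reflection of the copies `2` and `3` if `t` is even, and the identity if `t` is odd. -/
def reflectIfEven (t : ℕ) (x : Point) : Point := if t % 2 = 0 then reflect x else x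

/-- The two base classes, each with its two base cycles. -/
def baseCycle (t : ℕ) : Fin 2 → Bool → ℕ → Point
  | 0, false => fun n => reflectIfEven t (cycleA t n)
  | 0, true => fun n => reflectIfEven t (cycleB t n)
  | 1, false => cycleC t
  | 1, true => cycleD t

/-! ### The base cycles are vertex-disjoint -/

theorem cycleA_injOn {t n n' : ℕ} (hn : n < 4 * t + 2) (hn' : n' < 4 * t + 2)
    (h : cycleA t n = cycleA t n') : n = n' := by
  unfold cycleA zigzag at h
  split_ifs at h <;> simp at h <;> omega

theorem cycleB_injOn {t n n' : ℕ} (hn : n < 4 * t + 2) (hn' : n' < 4 * t + 2)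
    (h : cycleB t n = cycleB t n') : n = n' := by
  unfold cycleB zigzag at h
  split_ifs at h <;> simp at h <;> omega

theorem cycleA_ne_cycleB {t n n' : ℕ} (hn : n < 4 * t + 2) (hn' : n' < 4 * t + 2) :
    cycleA t n ≠ cycleB t n' := by
  intro h
  unfold cycleA cycleB zigzag at h
  split_ifs at h <;> simp at h <;> omega

theorem cycleC_injective (t : ℕ) : Function.Injective (cycleC t) := by
  intro n n' h
  unfold cycleC zigzag at h
  split_ifs at h <;> simp at h <;> omega

theorem cycleD_injective (t : ℕ) : Function.Injective (cycleD t) := by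
  intro n n' h
  unfold cycleD zigzag at h
  split_ifs at h <;> simp at h <;> omega

theorem cycleC_ne_cycleD {t n n' : ℕ} (hn : n < 4 * t + 2) :
    cycleC t n ≠ cycleD t n' := by
  intro h
  unfold cycleC cycleD zigzag at h
  split_ifs at h <;> simp at h <;> omega

/-- The left ends of intervals of length `2t + 1` which contain the positions of `cycleA` and
`cycleB` on the four copies. -/
def windowAB (t : ℕ) : Fin 4 → ℤ :=
  ![0, 0, (t / 2 : ℕ) - t, 1 - (t / 2 : ℕ)]

theorem cycleA_mem_window {t n : ℕ} (ht : 1 ≤ t) (hn : n < 4 * t + 2) :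
    ∀ z ∈ cycleA t n, windowAB t z.1 ≤ z.2 ∧ z.2 < windowAB t z.1 + (2 * t + 1 : ℕ) := by
  rintro ⟨i, p⟩ hz
  unfold cycleA zigzag at hz
  split_ifs at hz <;>
    simp only [Option.mem_def, Option.some.injEq, Prod.mk.injEq, reduceCtorEq] at hz <;>
    obtain ⟨rfl, rfl⟩ := hz <;> simp [windowAB] <;> omega

theorem cycleB_mem_window {t n : ℕ} (hn : n < 4 * t + 2) :
    ∀ z ∈ cycleB t n, windowAB t z.1 ≤ z.2 ∧ z.2 < windowAB t z.1 + (2 * t + 1 : ℕ) := by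
  rintro ⟨i, p⟩ hz
  unfold cycleB zigzag at hz
  split_ifs at hz <;>
    simp only [Option.mem_def, Option.some.injEq, Prod.mk.injEq] at hz <;>
    obtain ⟨rfl, rfl⟩ := hz <;> simp [windowAB] <;> omega

theorem cycleC_mem_window {t n : ℕ} (hn : n < 4 * t + 2) :
    ∀ z ∈ cycleC t n, (0 : ℤ) ≤ z.2 ∧ z.2 < 0 + (2 * t + 1 : ℕ) := by
  rintro ⟨i, p⟩ hz
  unfold cycleC zigzag at hz
  split_ifs at hz <;>
    simp only [Option.mem_def, Option.some.injEq, Prod.mk.injEq, reduceCtorEq] at hz <;>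
    obtain ⟨rfl, rfl⟩ := hz <;> simp <;> omega

theorem cycleD_mem_window {t n : ℕ} (ht : 1 ≤ t) (hn : n < 4 * t + 2) :
    ∀ z ∈ cycleD t n, (0 : ℤ) ≤ z.2 ∧ z.2 < 0 + (2 * t + 1 : ℕ) := by
  rintro ⟨i, p⟩ hz
  unfold cycleD zigzag at hz
  split_ifs at hz <;>
    simp only [Option.mem_def, Option.some.injEq, Prod.mk.injEq] at hz <;>
    obtain ⟨rfl, rfl⟩ := hz <;> simp <;> omega

theorem toVertex_reflect_inj {m : ℕ} {x y : Point}
    (h : (reflect x).toVertex m = (reflect y).toVertex m) : x.toVertex m = y.toVertex m := by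
  rcases x with _ | ⟨i, p⟩ <;> rcases y with _ | ⟨j, q⟩ <;>
    simp only [reflect, Point.toVertex, Option.map_none, Option.map_some, reduceCtorEq,
      Option.some.injEq, Prod.mk.injEq] at h ⊢
  obtain ⟨rfl, h⟩ := h
  refine ⟨rfl, ?_⟩
  fin_cases i <;> simpa using h

theorem toVertex_reflectIfEven_inj {m t : ℕ} {x y : Point}
    (h : (reflectIfEven t x).toVertex m = (reflectIfEven t y).toVertex m) :
    x.toVertex m = y.toVertex m := by
  unfold reflectIfEven at h
  split_ifs at h
  · exact toVertex_reflect_inj h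
  · exact h

theorem baseCycle_injOn {t : ℕ} (ht : 1 ≤ t) (c : Fin 2) (b b' : Bool) (n n' : ℕ)
    (hn : n < 4 * t + 2) (hn' : n' < 4 * t + 2)
    (h : (baseCycle t c b n).toVertex (2 * t + 1) = (baseCycle t c b' n').toVertex (2 * t + 1)) :
    b = b' ∧ n = n' := by
  have hA := cycleA_mem_window ht hn
  have hA' := cycleA_mem_window ht hn'
  have hB := cycleB_mem_window hn
  have hB' := cycleB_mem_window hn'
  have hC := cycleC_mem_window hn
  have hC' := cycleC_mem_window hn'
  have hD := cycleD_mem_window ht hn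
  have hD' := cycleD_mem_window ht hn'
  match c, b, b' with
  | 0, false, false =>
    exact ⟨rfl, cycleA_injOn hn hn' (toVertex_inj_of_window hA hA' (toVertex_reflectIfEven_inj h))⟩
  | 0, true, true =>
    exact ⟨rfl, cycleB_injOn hn hn' (toVertex_inj_of_window hB hB' (toVertex_reflectIfEven_inj h))⟩
  | 0, false, true =>
    exact absurd (toVertex_inj_of_window hA hB' (toVertex_reflectIfEven_inj h))
      (cycleA_ne_cycleB hn hn')
  | 0, true, false =>
    exact absurd (toVertex_inj_of_window hA' hB (toVertex_reflectIfEven_inj h.symm))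
      (cycleA_ne_cycleB hn' hn)
  | 1, false, false =>
    exact ⟨rfl, cycleC_injective t (toVertex_inj_of_window (lo := fun _ => 0) hC hC' h)⟩
  | 1, true, true =>
    exact ⟨rfl, cycleD_injective t (toVertex_inj_of_window (lo := fun _ => 0) hD hD' h)⟩
  | 1, false, true =>
    exact absurd (toVertex_inj_of_window (lo := fun _ => 0) hC hD' h) (cycleC_ne_cycleD hn)
  | 1, true, false =>
    exact absurd (toVertex_inj_of_window (lo := fun _ => 0) hC' hD h.symm)
      (cycleC_ne_cycleD hn')

/-! ### The differences of the base cycles -/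

/-- Reflection turns the difference `d` into `d'` if it does so for every pair of positions. -/
theorem HasDifference.of_reflect {m : ℕ} {f : ℕ → Point} {i j : Fin 4} {d d' : ZMod m}
    (h : HasDifference m f i j d)
    (hd : ∀ p q : ℤ, ((q - p : ℤ) : ZMod m) = d → ∃ p' q' : ℤ,
      reflect (some (i, p)) = some (i, p') ∧ reflect (some (j, q)) = some (j, q') ∧ ((q' - p' : ℤ) : ZMod m) = d') :
    HasDifference m (fun n => reflect (f n)) i j d' := by
  obtain ⟨p, q, h, hpq⟩ := h
  obtain ⟨p', q', hp, hq, hd⟩ := hd p q hpq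
  exact ⟨p', q', by simpa only [hp, hq] using h.map reflect, hd⟩

theorem Consecutive.reflectIfEven {k t : ℕ} {f : ℕ → Point} {x y : Point}
    (h : Consecutive k f x y) (hx : reflect x = x) (hy : reflect y = y) :
    Consecutive k (fun n => reflectIfEven t (f n)) x y := by
  unfold _root_.reflectIfEven
  split_ifs
  · simpa only [hx, hy] using h.map reflect
  · exact h

theorem HasDifference.reflectIfEven_of_le {m t : ℕ} {f : ℕ → Point} {i j : Fin 4} {d : ZMod m}
    (h : HasDifference m f i j d) (hi : i ≤ 1) (hj : j ≤ 1) :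
    HasDifference m (fun n => reflectIfEven t (f n)) i j d := by
  unfold reflectIfEven
  split_ifs
  · refine h.of_reflect fun p q hd => ⟨p, q, ?_, ?_, hd⟩ <;>
    fin_cases i <;> fin_cases j <;> simp_all [reflect]
  · exact h

theorem HasDifference.reflectIfEven_pure {m t : ℕ} {f : ℕ → Point} {i : Fin 4} {d : ZMod m}
    (h : HasDifference m f i i d) :
    HasDifference m (fun n => reflectIfEven t (f n)) i i d := by
  by_cases hi : i ≤ 1
  · exact h.reflectIfEven_of_le hi hi
  unfold reflectIfEven
  split_ifs
  · refine h.symm.of_reflect fun p q hd => ?_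
    push_cast at hd ⊢
    obtain rfl | rfl : i = 2 ∨ i = 3 := by omega
    · exact ⟨-1 - p, -1 - q, by simp [reflect], by simp [reflect], by
        push_cast; linear_combination -hd⟩
    · exact ⟨2 - p, 2 - q, by simp [reflect], by simp [reflect], by
        push_cast; linear_combination -hd⟩
  · exact h

theorem HasDifference.reflectIfEven_two_three {m t : ℕ} {f : ℕ → Point} {d : ZMod m}
    (h : HasDifference m f 2 3 (if t % 2 = 0 then 3 - d else d)) :
    HasDifference m (fun n => reflectIfEven t (f n)) 2 3 d := by
  unfold reflectIfEven
  split_ifs at h ⊢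
  · refine h.of_reflect fun p q hd => ⟨-1 - p, 2 - q, by simp [reflect], by simp [reflect], ?_⟩
    push_cast at hd ⊢
    linear_combination -hd
  · exact h

variable {t : ℕ}

theorem cycleA_zero_one (ht : 1 ≤ t) {d : ℤ} (h₁ : 3 ≤ d) (h₂ : d ≤ 2 * t) :
    HasDifference (2 * t + 1) (cycleA t) 0 1 d := by
  have : HasDifference (2 * t + 1) (cycleA t) 1 0 ((-d : ℤ) : ZMod (2 * t + 1)) := by
    refine .of_zigzag (i := 1) (j := 0) (p := 1) (q := 2 * t - 1) (d - 2).toNat (d - 3).toNat 1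
      (by omega) ?_ ?_ (by push_cast; omega) <;>
    · unfold cycleA zigzag
      split_ifs <;> first | omega | (simp; omega)
  simpa using this.symm

theorem cycleA_zero_zero (ht : 1 ≤ t) {d : ℤ} (h₁ : 1 ≤ d) (h₂ : d ≤ t) :
    HasDifference (2 * t + 1) (cycleA t) 0 0 d := by
  refine .of_zigzag_reverse (p := 0) (q := t) (3 * t + d).toNat (t - d).toNat 0
    (by omega) ?_ ?_ (by push_cast; omega) <;>
  · unfold cycleA zigzag
    split_ifs <;> first | omega | (simp; omega)

theorem cycleA_one_one (ht : 1 ≤ t) {d : ℤ} (h₁ : 1 ≤ d) (h₂ : d ≤ t) :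
    HasDifference (2 * t + 1) (cycleA t) 1 1 d := by
  refine .of_zigzag (p := t) (q := 2 * t) (3 * t - 1 - d).toNat (t - d).toNat 0
    (by omega) ?_ ?_ (by push_cast; omega) <;>
  · unfold cycleA zigzag
    split_ifs <;> first | omega | (simp; omega)

theorem cycleB_two_two {d : ℤ} (h₁ : 1 ≤ d) (h₂ : d ≤ t) :
    HasDifference (2 * t + 1) (cycleB t) 2 2 d := by
  refine .of_zigzag_reverse (p := (t / 2 : ℕ)) (q := (t / 2 : ℕ) + t) (d - 1).toNat
    (t - d).toNat 0 (by omega) ?_ ?_ (by push_cast; omega) <;>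
  · unfold cycleB zigzag
    split_ifs <;> first | omega | (simp; omega)

theorem cycleB_three_three {d : ℤ} (h₁ : 1 ≤ d) (h₂ : d ≤ t) :
    HasDifference (2 * t + 1) (cycleB t) 3 3 d := by
  refine .of_zigzag (p := t - (t / 2 : ℕ) + 1) (q := 2 * t - (t / 2 : ℕ) + 1)
    (4 * t + 1 - d).toNat (t - d).toNat 0 (by omega) ?_ ?_ (by push_cast; omega) <;>
  · unfold cycleB zigzag
    split_ifs <;> first | omega | (simp; omega)

/-- The zigzag between the copies `3` and `2` skips the differences `1` and `2`, and the closing edge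
of `cycleB` supplies the one of them which is determined by the parity of `t`. -/
theorem cycleB_two_three (ht : 1 ≤ t) {d : ZMod (2 * t + 1)}
    (hd : d ≠ if t % 2 = 0 then 2 else 1) : HasDifference (2 * t + 1) (cycleB t) 2 3 d := by
  obtain ⟨d, h₁, h₂, rfl⟩ := exists_intCast_eq (1 - 2 * (t / 2 : ℕ) : ℤ) d
  push_cast at h₂
  -- The closing edge joins the middles of the zigzags within the copies `2` and `3`.
  by_cases hlink : d = t - 2 * (t / 2 : ℕ) + 1
  · refine .of_consecutive (p := (t / 2 : ℕ) + ((t + 1) / 2 : ℕ))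
      (q := t - (t / 2 : ℕ) + 1 + ((t + 1) / 2 : ℕ)) 0
      (consecutive_last (by omega) ?_ ?_).symm (by omega) <;>
    · unfold cycleB zigzag
      split_ifs <;> first | omega | (simp; omega)
  have hd' : d ≠ 1 ∧ d ≠ 2 := by
    constructor <;> rintro rfl <;> split_ifs at hd <;> first | omega | simp at hd
  -- The edge from the zigzag within copy `2` to the zigzag between the copies `3` and `2`; it exists
  -- unless `t = 1`, where the detour through copy `1` takes its place.
  by_cases hfirst : d = 1 - 2 * (t / 2 : ℕ)
  · refine .of_consecutive (p := (t / 2 : ℕ)) (q := 1 - (t / 2 : ℕ)) 0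
      (consecutive_of_lt t (by omega) ?_ ?_) (by omega) <;>
    · unfold cycleB zigzag
      split_ifs <;> first | omega | simp
  have : HasDifference (2 * t + 1) (cycleB t) 3 2 ((-d : ℤ) : ZMod (2 * t + 1)) := by
    refine .of_zigzag (p := 1 - (t / 2 : ℕ)) (q := (t / 2 : ℕ) - 1)
      (t - 1 + d + 2 * (t / 2 : ℕ)).toNat (d - 2 + 2 * (t / 2 : ℕ)).toNat 0
      (by omega) ?_ ?_ (by push_cast; omega) <;>
    · unfold cycleB zigzag
      split_ifs <;> first | omega | (simp; omega)
  simpa using this.symm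

theorem cycleC_zero_two (d : ZMod (2 * t + 1)) (ht : 1 ≤ t) :
    HasDifference (2 * t + 1) (cycleC t) 0 2 d := by
  obtain ⟨d, h₁, h₂, rfl⟩ := exists_intCast_eq 0 d
  push_cast at h₂
  refine .of_zigzag (p := -1) (q := 2 * t) (2 * t + 1 - d).toNat (2 * t + 1 - d).toNat 0
    (by omega) ?_ ?_ (by push_cast; omega) <;>
  · unfold cycleC zigzag
    split_ifs <;> first | omega | simp

theorem cycleC_zero_three {d : ℤ} (h₁ : 2 ≤ d) (h₂ : d ≤ 2 * t) :
    HasDifference (2 * t + 1) (cycleC t) 0 3 d := by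
  refine .of_zigzag (p := t) (q := t - 1) (4 * t + 2 - d).toNat (2 * t - d).toNat (-1)
    (by omega) ?_ ?_ (by push_cast; omega) <;>
  · unfold cycleC zigzag
    split_ifs <;> first | omega | (simp; omega)

theorem cycleD_one_two {d : ℤ} (h₁ : 1 ≤ d) (h₂ : d ≤ 2 * t - 1) :
    HasDifference (2 * t + 1) (cycleD t) 1 2 d := by
  have : HasDifference (2 * t + 1) (cycleD t) 2 1 ((-d : ℤ) : ZMod (2 * t + 1)) := by
    refine .of_zigzag (p := -1) (q := 2 * t) d.toNat d.toNat 1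
      (by omega) ?_ ?_ (by push_cast; omega) <;>
    · unfold cycleD zigzag
      split_ifs <;> first | omega | (simp <;> omega)
  simpa using this.symm

theorem cycleD_one_three {d : ℤ} (h₁ : 1 ≤ d) (h₂ : d ≤ 2 * t) :
    HasDifference (2 * t + 1) (cycleD t) 1 3 d := by
  have : HasDifference (2 * t + 1) (cycleD t) 3 1 ((-d : ℤ) : ZMod (2 * t + 1)) := by
    refine .of_zigzag (p := t) (q := t - 1) (2 * t + d).toNat (d - 1).toNat 0
      (by omega) ?_ ?_ (by push_cast; omega) <;>
    · unfold cycleD zigzag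
      split_ifs <;> first | omega | (simp; omega)
  simpa using this.symm

theorem cycleD_zero_one (ht : 1 ≤ t) : HasDifference (2 * t + 1) (cycleD t) 0 1 0 := by
  have : 1 ≤ 2 * t := by omega
  exact ⟨2 * t, 2 * t, consecutive_of_lt 0 (by omega) (by simp [cycleD])
    (by simp [cycleD, zigzag, this]), by simp⟩

theorem cycleD_zero_three : HasDifference (2 * t + 1) (cycleD t) 0 3 0 := by
  refine ⟨2 * t, 2 * t, (consecutive_last (by omega) ?_ ?_).symm, by simp⟩ <;>
  · unfold cycleD zigzag
    split_ifs <;> first | omega | (simp <;> omega)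

theorem cycleD_two_three (ht : 1 ≤ t) : HasDifference (2 * t + 1) (cycleD t) 2 3 1 := by
  refine ⟨t - 1, t, consecutive_of_lt (2 * t) (by omega) ?_ ?_, by simp⟩ <;>
  · unfold cycleD zigzag
    split_ifs <;> first | omega | (simp <;> omega)

theorem baseCycle_zero_three : HasDifference (2 * t + 1) (baseCycle t 0 false) 0 3 1 := by
  have h : Consecutive (2 * (2 * t + 1)) (cycleA t) (some (0, 0)) (some (3, 1)) := by
    refine consecutive_last (by omega) ?_ ?_ <;>
    · unfold cycleA zigzag
      split_ifs <;> first | omega | (simp <;> omega)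
  exact ⟨0, 1, h.reflectIfEven (by simp [reflect]) (by simp [reflect]), by simp⟩

theorem baseCycle_one_three (ht : 1 ≤ t) :
    HasDifference (2 * t + 1) (baseCycle t 0 false) 1 3 0 := by
  have h : Consecutive (2 * (2 * t + 1)) (cycleA t) (some (3, 1)) (some (1, 1)) := by
    have : 1 ≤ 2 * t - 1 := by omega
    exact consecutive_of_lt 0 (by omega) (by simp [cycleA]) (by simp [cycleA, zigzag, this])
  exact ⟨1, 1, h.symm.reflectIfEven (by simp [reflect]) (by simp [reflect]), by simp⟩

/-- The point of copy `1` on `cycleB` supplies the two differences which `cycleD` leaves over. -/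
theorem baseCycle_one_two (ht : 1 ≤ t) :
    HasDifference (2 * t + 1) (baseCycle t 0 true) 1 2 0 ∧
      HasDifference (2 * t + 1) (baseCycle t 0 true) 1 2 (-1) := by
  have h₀ : Consecutive (2 * (2 * t + 1)) (cycleB t) (some (2, 0)) (some (1, 0)) := by
    refine consecutive_of_lt (t + 2 * (t / 2)) (by omega) ?_ ?_ <;>
    · unfold cycleB zigzag
      split_ifs <;> first | omega | (simp <;> omega)
  have h₁ : Consecutive (2 * (2 * t + 1)) (cycleB t) (some (1, 0)) (some (2, -1)) := by
    refine consecutive_of_lt (t + 1 + 2 * (t / 2)) (by omega) ?_ ?_ <;>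
    · unfold cycleB zigzag
      split_ifs <;> first | omega | (simp <;> omega)
  replace h₀ := h₀.symm.map (reflectIfEven t)
  replace h₁ := h₁.map (reflectIfEven t)
  by_cases h : t % 2 = 0
  · simp only [reflectIfEven, h, if_true] at h₀ h₁
    constructor
    · refine ⟨0, 0, ?_, by simp⟩
      simpa [baseCycle, reflectIfEven, h, reflect] using h₁
    · refine ⟨0, -1, ?_, by simp⟩
      simpa [baseCycle, reflectIfEven, h, reflect] using h₀
  · simp only [reflectIfEven, h, if_false] at h₀ h₁
    constructor
    · refine ⟨0, 0, ?_, by simp⟩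
      simpa [baseCycle, reflectIfEven, h, reflect] using h₀
    · refine ⟨0, -1, ?_, by simp⟩
      simpa [baseCycle, reflectIfEven, h, reflect] using h₁

theorem baseCycle_infty (ht : 1 ≤ t) (i : Fin 4) : ∃ c b p,
    Consecutive (2 * (2 * t + 1)) (baseCycle t c b) none (some (i, p)) := by
  match i with
  | 0 =>
    obtain ⟨x, hx⟩ := exists_zigzag_self 0 0 t t
    refine ⟨0, false, x, ?_⟩
    have h : Consecutive (2 * (2 * t + 1)) (cycleA t) none (some (0, x)) := by
      rw [← hx]
      refine consecutive_of_lt (3 * t) (by omega) ?_ ?_ <;>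
      · unfold cycleA zigzag
        split_ifs <;> first | omega | (simp <;> omega)
    exact h.reflectIfEven (by simp [reflect]) (by simp [reflect])
  | 1 =>
    obtain ⟨x, hx⟩ := exists_zigzag_self 1 t (2 * t) t
    refine ⟨0, false, x, ?_⟩
    have h : Consecutive (2 * (2 * t + 1)) (cycleA t) (some (1, x)) none := by
      rw [← hx]
      refine consecutive_of_lt (3 * t - 1) (by omega) ?_ ?_ <;>
      · unfold cycleA zigzag
        split_ifs <;> first | omega | (simp <;> omega)
    exact h.symm.reflectIfEven (by simp [reflect]) (by simp [reflect])
  | 2 =>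
    refine ⟨1, false, 2 * t, ?_⟩
    exact consecutive_of_lt (f := cycleC t) 0 (by omega) (by simp [cycleC])
      (by simp [cycleC, zigzag])
  | 3 =>
    refine ⟨1, false, 0, (consecutive_last (f := cycleC t) (by omega) ?_ ?_).symm⟩ <;>
    · unfold cycleC zigzag
      split_ifs <;> first | omega | (simp <;> omega)

theorem baseCycle_pure (ht : 1 ≤ t) (i : Fin 4) (d : ZMod (2 * t + 1)) (hd : d ≠ 0) :
    ∃ c b, HasDifference (2 * t + 1) (baseCycle t c b) i i d := by
  -- Up to sign, every non-zero residue modulo `2t + 1` is one of `1, …, t`.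
  suffices H : ∃ c b, ∀ d : ℤ, 1 ≤ d → d ≤ t →
      HasDifference (2 * t + 1) (baseCycle t c b) i i d by
    obtain ⟨c, b, H⟩ := H
    refine ⟨c, b, ?_⟩
    obtain ⟨d, h₁, h₂, rfl⟩ := exists_intCast_eq (-t : ℤ) d
    push_cast at h₂
    rcases lt_trichotomy d 0 with h | rfl | h
    · simpa using (H (-d) (by omega) (by omega)).symm
    · simp at hd
    · exact H d (by omega) (by omega)
  match i with
  | 0 => exact ⟨0, false, fun d h₁ h₂ => (cycleA_zero_zero ht h₁ h₂).reflectIfEven_pure⟩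
  | 1 => exact ⟨0, false, fun d h₁ h₂ => (cycleA_one_one ht h₁ h₂).reflectIfEven_pure⟩
  | 2 => exact ⟨0, true, fun d h₁ h₂ => (cycleB_two_two h₁ h₂).reflectIfEven_pure⟩
  | 3 => exact ⟨0, true, fun d h₁ h₂ => (cycleB_three_three h₁ h₂).reflectIfEven_pure⟩

theorem baseCycle_mixed (ht : 1 ≤ t) (i j : Fin 4) (d : ZMod (2 * t + 1)) (hij : i < j) :
    (∃ c b, HasDifference (2 * t + 1) (baseCycle t c b) i j d) ∨
      i = 0 ∧ j = 1 ∧ (d = 1 ∨ d = 2) := by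
  obtain ⟨e, h₁, h₂, he⟩ := exists_intCast_eq 0 d
  push_cast at h₂
  rcases (by omega : i = 0 ∧ j = 1 ∨ i = 0 ∧ j = 2 ∨ i = 0 ∧ j = 3 ∨ i = 1 ∧ j = 2 ∨
    i = 1 ∧ j = 3 ∨ i = 2 ∧ j = 3) with
    ⟨rfl, rfl⟩ | ⟨rfl, rfl⟩ | ⟨rfl, rfl⟩ | ⟨rfl, rfl⟩ | ⟨rfl, rfl⟩ | ⟨rfl, rfl⟩
  · rcases (by omega : e = 0 ∨ e = 1 ∨ e = 2 ∨ 3 ≤ e) with rfl | rfl | rfl | h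
    · exact Or.inl ⟨1, true, by rw [← he, Int.cast_zero]; exact cycleD_zero_one ht⟩
    · exact Or.inr ⟨rfl, rfl, Or.inl (by simp [← he])⟩
    · exact Or.inr ⟨rfl, rfl, Or.inr (by simp [← he])⟩
    · refine Or.inl ⟨0, false, he ▸ ?_⟩
      exact (cycleA_zero_one ht h (by omega)).reflectIfEven_of_le (by simp) (by simp)
  · exact Or.inl ⟨1, false, cycleC_zero_two d ht⟩
  · rcases (by omega : e = 0 ∨ e = 1 ∨ 2 ≤ e) with rfl | rfl | h
    · exact Or.inl ⟨1, true, by rw [← he, Int.cast_zero]; exact cycleD_zero_three⟩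
    · exact Or.inl ⟨0, false, by simpa [← he] using baseCycle_zero_three⟩
    · exact Or.inl ⟨1, false, he ▸ cycleC_zero_three h (by omega)⟩
  · rcases (by omega : e = 0 ∨ e = 2 * t ∨ 1 ≤ e ∧ e ≤ 2 * t - 1) with rfl | rfl | h
    · exact Or.inl ⟨0, true, by simpa [← he] using (baseCycle_one_two ht).1⟩
    · have hd : d = -1 := by
        have := ZMod.natCast_self (2 * t + 1)
        push_cast at this he
        linear_combination this - he
      exact Or.inl ⟨0, true, hd ▸ (baseCycle_one_two ht).2⟩
    · exact Or.inl ⟨1, true, he ▸ cycleD_one_two h.1 h.2⟩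
  · rcases (by omega : e = 0 ∨ 1 ≤ e) with rfl | h
    · exact Or.inl ⟨0, false, by simpa [← he] using baseCycle_one_three ht⟩
    · exact Or.inl ⟨1, true, he ▸ cycleD_one_three h (by omega)⟩
  · by_cases hd : d = 1
    · exact Or.inl ⟨1, true, hd ▸ cycleD_two_three ht⟩
    · refine Or.inl ⟨0, true, HasDifference.reflectIfEven_two_three (cycleB_two_three ht ?_)⟩
      split_ifs
      · intro h
        exact hd (by linear_combination -h)
      · exact hd

theorem lemma3 (k : ℕ) (hk : 18 ≤ k) (hk4 : k ≡ 2 [MOD 4]) : ExistsARCS k (2 * k + 1) := by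
  obtain ⟨t, rfl⟩ : ∃ t, k = 2 * (2 * t + 1) := ⟨k / 4, by unfold Nat.ModEq at hk4; omega⟩
  have ht : 1 ≤ t := by omega
  exact existsARCS_of_differences (by omega) (baseCycle t)
    (fun c b b' n n' hn hn' h => baseCycle_injOn ht c b b' n n' (by omega) (by omega) h)
    (baseCycle_infty ht) (baseCycle_pure ht) (baseCycle_mixed ht)
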